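/- Let $\lambda,\mu\in\mathbb R$, let $\mathcal U:\mathbb S^2\to[0,\infty)$ (the potential) and $\sigma:\mathbb R^2\to\mathbb R$ (the impurity) be continuous, and let $\vec\phi:\mathbb R^2\to\mathbb S^2\subset\mathbb R^3$ be of class $C^2$. Put $$B_0=\frac1{8\pi}\sum_{i,j=1}^2\epsilon^{ij}\,\vec\phi\cdot(\partial_i\vec\phi\times\partial_j\vec\phi),\qquad B=\int_{\mathbb R^2} B_0\,d^2x,\qquad \langle\sqrt{\mathcal U}\rangle=\frac1{4\pi}\int_{\mathbb S^2}\sqrt{\mathcal U}\,d\Omega ,$$ with $\epsilon^{12}=1$, and $$\mathcal E=\lambda^2B_0^2+\mu^2\,\mathcal U(\vec\phi)-2\lambda\sigma B_0+2\mu\sigma\sqrt{\mathcal U(\vec\phi)}+\sigma^2,\qquad E=\int_{\mathbb R^2}\mathcal E\,d^2x .$$ (a) Suppose that $\vec\phi(x)$ tends to some constant $\vec\phi_\infty\in\mathbb S^2$ as $|x|\to\infty$ and that $B_0$ is integrable. Then $\int_{\mathbb R^2} B_0\sqrt{\mathcal U(\vec\phi)}\,d^2x=B\,\langle\sqrt{\mathcal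 U}\rangle$. If the energy is finite ($\mathcal E$ is integrable), then $$E=\int_{\mathbb R^2}\bigl(\lambda B_0-\mu\sqrt{\mathcal U(\vec\phi)}-\sigma\bigr)^2d^2x+2\lambda\mu\int_{\mathbb R^2} B_0\sqrt{\mathcal U(\vec\phi)}\,d^2x\;\ge\;2\lambda\mu B\,\langle\sqrt{\mathcal U}\rangle .$$ Moreover, the energy is finite with $E=2\lambda\mu B\,\langle\sqrt{\mathcal U}\rangle$ if and only if the Bogomolnyi equation $\lambda B_0-\mu\sqrt{\mathcal U(\vec\phi)}-\sigma=0$ holds everywhere on $\mathbb R^2$. (b) Suppose that $\lambda B_0-\mu\sqrt{\mathcal U(\vec\phi)}-\sigma=0$ everywhere on $\mathbb R^2$ (no condition at infinity and no integrability is needed here). Then $\vec\phi$ solves the full static Euler–Lagrange equations of $E$: at every point $x$ such that $\sqrt{\mathcal U}$ is differentiable at $\vec\phi(x)$, and for every smooth local coordinate system $(\xi^1,\xi^2)$ of $\mathbb S^2$ around $\vec\phi(x)$, all derivatives in $$\sum_{j=1}^2\partial_j\frac{\partial\mathcal E}{\partial\xi^a_j}-\frac{\partial\mathcal E}{\partial\xi^a}=0\qquad(a=1,2)$$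 exist and the equations hold at $x$, where $\mathcal E$ is regarded as a function of $x$, $\xi^a$ and $\xi^a_j=\partial_j\xi^a$. -/

import Mathlib

open Filter Topology MeasureTheory
open scoped Manifold ContDiff Matrix

noncomputable section

namespace BabySkyrme

/-- The physical plane, with its Euclidean structure and Lebesgue measure. -/
abbrev Plane : Type := EuclideanSpace ℝ (Fin 2)

/-- Isospace. -/
abbrev Iso : Type := EuclideanSpace ℝ (Fin 3)

/-- The target space: the unit sphere in isospace. -/
abbrev S2 : Type := Metric.sphere (0 : Iso) 1

/-- The dimension fact by which Mathlib equips the unit sphere with its smooth structure. -/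
instance factFinrankIso : Fact (Module.finrank ℝ Iso = 2 + 1) := ⟨by simp⟩

/-- The standard basis vector with index `i`. -/
def basisVec {n : ℕ} (i : Fin n) : EuclideanSpace ℝ (Fin n) := EuclideanSpace.single i 1

/-- The partial derivative `∂_j f (x)` of a function on the plane. -/
def pd {F : Type*} [NormedAddCommGroup F] [NormedSpace ℝ F]
    (j : Fin 2) (f : Plane → F) (x : Plane) : F :=
  fderiv ℝ f x (basisVec j)

/-- The triple product `a · (b × c)` in isospace. -/
def triple (a b c : Iso) : ℝ := a.ofLp ⬝ᵥ (b.ofLp ⨯₃ c.ofLp)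

/-- The charge density of a first-order jet: field value `m`, spatial derivatives `v 0`, `v 1`.
It is `(1 / 8π) ε^{ij} m · (v_i × v_j)` with `ε^{12} = 1`. -/
def chargeJet (m : Iso) (v : Fin 2 → Iso) : ℝ :=
  1 / (8 * Real.pi) * (triple m (v 0) (v 1) - triple m (v 1) (v 0))

/-- The topological charge density `B₀` of a field with values in the unit sphere. -/
def chargeDensity (φ : Plane → S2) (x : Plane) : ℝ :=
  chargeJet (φ x) (fun j => pd j (fun y => (φ y : Iso)) x)

/-- The topological charge `B = ∫ B₀ d²x`. -/
def charge (φ : Plane → S2) : ℝ := ∫ x, chargeDensity φ x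

/-- The energy density as a function of the values `s` of the impurity, `b` of the charge density
and `u` of the potential. -/
def density (lam mu s b u : ℝ) : ℝ :=
  lam ^ 2 * b ^ 2 + mu ^ 2 * u - 2 * lam * s * b + 2 * mu * s * √u + s ^ 2

/-- The static energy density of a field. -/
def energyDensity (lam mu : ℝ) (U : S2 → ℝ) (σ : Plane → ℝ) (φ : Plane → S2) (x : Plane) : ℝ :=
  density lam mu (σ x) (chargeDensity φ x) (U (φ x))

/-- The static energy (meaningful when the energy density is integrable). -/
def energy (lam mu : ℝ) (U : S2 → ℝ) (σ : Plane → ℝ) (φ : Plane → S2) : ℝ :=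
  ∫ x, energyDensity lam mu U σ φ x

/-- The average of `√U` over the unit sphere with respect to the area measure. -/
def avgSqrt (U : S2 → ℝ) : ℝ := ⨍ m, √(U m) ∂((volume : Measure Iso).toSphere)

/-- The left-hand side `λ B₀ - μ √U - σ` of the Bogomolnyi equation. -/
def bogomolnyi (lam mu : ℝ) (U : S2 → ℝ) (σ : Plane → ℝ) (φ : Plane → S2) (x : Plane) : ℝ :=
  lam * chargeDensity φ x - mu * √(U (φ x)) - σ x

/-- The momentum `∂L / ∂ξ^a_j` along a coordinate field `ξ`, as a function of the position.
A Lagrangian takes the position, the value of the field, and its two spatial derivatives. -/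
def momentum (L : Plane → Plane → (Fin 2 → Plane) → ℝ) (ξ : Plane → Plane) (a j : Fin 2)
    (x : Plane) : ℝ :=
  fderiv ℝ (L x (ξ x)) (fun i => pd i ξ x) (Pi.single j (basisVec a))

/-- The Euler-Lagrange equations `∂_j (∂L / ∂ξ^a_j) - ∂L / ∂ξ^a = 0`, `a = 1, 2`, at the point `x`,
including the existence of all derivatives that occur in them. -/
structure EulerLagrangeAt (L : Plane → Plane → (Fin 2 → Plane) → ℝ) (ξ : Plane → Plane)
    (x : Plane) : Prop where
  field_differentiable : ∀ᶠ y in 𝓝 x, DifferentiableAt ℝ ξ y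
  jet_differentiable : ∀ᶠ y in 𝓝 x, DifferentiableAt ℝ (L y (ξ y)) (fun i => pd i ξ y)
  value_differentiable : DifferentiableAt ℝ (fun q => L x q (fun i => pd i ξ x)) (ξ x)
  momentum_differentiable : ∀ a j, DifferentiableAt ℝ (momentum L ξ a j) x
  equation : ∀ a : Fin 2,
    (∑ j : Fin 2, pd j (momentum L ξ a j) x)
      - pd a (fun q => L x q (fun i => pd i ξ x)) (ξ x) = 0

/-- The static energy density in local coordinates `e` of the target sphere: the field has
coordinates `q`, and its spatial derivatives have coordinates `P 0`, `P 1`. -/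
def chartLagrangian (lam mu : ℝ) (U : S2 → ℝ) (σ : Plane → ℝ) (e : OpenPartialHomeomorph S2 Plane)
    (x q : Plane) (P : Fin 2 → Plane) : ℝ :=
  density lam mu (σ x)
    (chargeJet (e.symm q) (fun j => fderiv ℝ (fun r => (e.symm r : Iso)) q (P j)))
    (U (e.symm q))

/-- The static Euler-Lagrange equations of the energy hold for `φ` at `x`: they hold in every
smooth local coordinate system of the target sphere around `φ x`. -/
def StaticEulerLagrangeAt (lam mu : ℝ) (U : S2 → ℝ) (σ : Plane → ℝ) (φ : Plane → S2)
    (x : Plane) : Prop :=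
  ∀ e ∈ IsManifold.maximalAtlas (𝓡 2) ∞ S2, φ x ∈ e.source →
    EulerLagrangeAt (chartLagrangian lam mu U σ e) (fun y => e (φ y)) x

end BabySkyrme

end

noncomputable section

namespace BabySkyrme

/-! Since `U = (√U)²`, completing the square splits the energy density into `(λB₀ - μ√U - σ)²` and
`2λμ B₀√U`. Both halves of the theorem rest on this splitting.

For (a) it remains to see that `∫ B₀ f(φ)` depends on a continuous `f` only through its mean over
the sphere. Let `D` be the difference of `f ↦ ∫ B₀ f(φ)` and `B` times the mean; it is continuous
and `D 1 = 0`. Such a functional is zero as soon as it kills derivatives along rotation fields: on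
polynomials this reduces every moment to that of `1`, and polynomials are dense
(`eq_zero_of_rotDeriv`). The mean kills these derivatives because the area is rotation invariant.
For the charge term, the area form contracted with `m ↦ a × m` is exact, with primitive `⟨a, m⟩` up
to sign, so the integrand is a multiple of the Jacobian of `(g ∘ φ, ⟨a, φ⟩)`
(`rotDeriv_mul_chargeDensity`). That integrates to zero because `g ∘ φ` has a limit at infinity
(`integral_jac_eq_zero`). The cutoff is made in the values of `g ∘ φ`, not in space, so no decay of
derivatives is needed.

For (b), the square contributes nothing to the Euler-Lagrange equations where its base vanishes, and
in local coordinates the rest has the form `F(ξ) det ∂ξ`, a null Lagrangian (`sum_pd_mul_cof`). -/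

/-! ### Jacobians on the plane and their integrals -/

/-- The Jacobian determinant of a pair of functions on the plane. -/
def jac (G H : Plane → ℝ) (x : Plane) : ℝ := pd 0 G x * pd 1 H x - pd 1 G x * pd 0 H x

lemma continuous_pd {F : Type*} [NormedAddCommGroup F] [NormedSpace ℝ F] {f : Plane → F}
    (hf : ContDiff ℝ 1 f) (j : Fin 2) : Continuous (pd j f) :=
  (hf.continuous_fderiv (by norm_num)).clm_apply continuous_const

lemma contDiff_pd {F : Type*} [NormedAddCommGroup F] [NormedSpace ℝ F] {f : Plane → F}
    (hf : ContDiff ℝ 2 f) (j : Fin 2) : ContDiff ℝ 1 (pd j f) :=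
  (hf.fderiv_right (m := 1) (by norm_num)).clm_apply contDiff_const

lemma continuous_jac {G H : Plane → ℝ} (hG : ContDiff ℝ 1 G) (hH : ContDiff ℝ 1 H) :
    Continuous (jac G H) :=
  ((continuous_pd hG 0).mul (continuous_pd hH 1)).sub ((continuous_pd hG 1).mul (continuous_pd hH 0))

lemma pd_pd_comm {F : Type*} [NormedAddCommGroup F] [NormedSpace ℝ F] {f : Plane → F} {x : Plane}
    (hf : ContDiffAt ℝ 2 f x) (i j : Fin 2) : pd i (pd j f) x = pd j (pd i f) x := by
  have h1 : DifferentiableAt ℝ (fderiv ℝ f) x :=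
    (hf.fderiv_right (m := 1) (by norm_num)).differentiableAt (by norm_num)
  have h2 := hf.isSymmSndFDerivAt (by simp)
  have h3 : ∀ i j : Fin 2, pd i (pd j f) x = fderiv ℝ (fderiv ℝ f) x (basisVec i) (basisVec j) := by
    intro i j
    change fderiv ℝ (fun y => fderiv ℝ f y (basisVec j)) x (basisVec i) = _
    rw [fderiv_clm_apply h1 (differentiableAt_const _)]
    simp
  rw [h3, h3]
  exact h2 _ _

/-- Integration by parts moves the derivative from `G` to `H` and leaves `G` times a commutator of
second derivatives of `H`. -/
lemma integral_jac_of_hasCompactSupport {G H : Plane → ℝ} (hG : ContDiff ℝ 1 G)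
    (hc : HasCompactSupport G) (hH : ContDiff ℝ 2 H) : ∫ x, jac G H x = 0 := by
  have hH1 : ContDiff ℝ 1 H := hH.of_le (by norm_num)
  have hcj : ∀ j, HasCompactSupport (pd j G) := fun j => hc.fderiv_apply ℝ (basisVec j)
  have key : ∀ i j : Fin 2, Integrable (fun x => pd i G x * pd j H x) ∧
      Integrable (fun x => G x * pd i (pd j H) x) ∧
      ∫ x, G x * pd i (pd j H) x = - ∫ x, pd i G x * pd j H x := by
    intro i j
    have a1 : Integrable (fun x => pd i G x * pd j H x) :=
      ((continuous_pd hG i).mul (continuous_pd hH1 j)).integrable_of_hasCompactSupport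
        (hcj i).mul_right
    have a2 : Integrable (fun x => G x * pd i (pd j H) x) :=
      (hG.continuous.mul (continuous_pd (contDiff_pd hH j) i)).integrable_of_hasCompactSupport
        hc.mul_right
    have a3 : Integrable (fun x => G x * pd j H x) :=
      (hG.continuous.mul (continuous_pd hH1 j)).integrable_of_hasCompactSupport hc.mul_right
    exact ⟨a1, a2, integral_mul_fderiv_eq_neg_fderiv_mul_of_integrable a1 a2 a3
      (fun x _ => hG.differentiable (by norm_num) x)
      (fun x _ => (contDiff_pd hH j).differentiable (by norm_num) x)⟩
  unfold jac
  rw [integral_sub (key 0 1).1 (key 1 0).1, ← neg_inj, neg_sub, sub_eq_neg_add, ← (key 0 1).2.2,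
    ← neg_neg (∫ x, pd 1 G x * pd 0 H x), ← (key 1 0).2.2]
  simp_rw [pd_pd_comm hH.contDiffAt 1 0]
  simp

/-- Almost everywhere on a level set, the derivative vanishes. -/
lemma ae_pd_eq_zero_of_eq {G : Plane → ℝ} (hG : ContDiff ℝ 1 G) (c : ℝ) (j : Fin 2) :
    ∀ᵐ x, G x = c → pd j G x = 0 := by
  have hmeas : MeasurableSet {x | G x = c → pd j G x = 0} := by
    have h1 : MeasurableSet {x | G x = c} :=
      (isClosed_eq hG.continuous continuous_const).measurableSet
    have h2 : MeasurableSet {x | pd j G x = 0} :=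
      (isClosed_eq (continuous_pd hG j) continuous_const).measurableSet
    have : {x | G x = c → pd j G x = 0} = {x | G x = c}ᶜ ∪ {x | pd j G x = 0} := by
      ext x; simp [imp_iff_not_or]
    rw [this]
    exact h1.compl.union h2
  -- Fubini along lines in direction `j`: on each line a bad point is an isolated zero of `G - c`,
  -- having nonzero derivative there, so the bad points form a null set.
  refine ae_mem_of_ae_add_linearMap_mem
    (LinearMap.toSpanSingleton ℝ Plane (basisVec j)) (volume : Measure ℝ) volume hmeas fun y => ?_
  rw [ae_iff]
  refine measure_null_of_locally_null _ fun t ht => ⟨{t}, ?_, by simp⟩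
  obtain ⟨h1, h2⟩ : G (y + t • basisVec j) = c ∧ pd j G (y + t • basisVec j) ≠ 0 :=
    Classical.not_imp.1 ht
  have hd : HasDerivAt (fun s : ℝ => G (y + s • basisVec j)) (pd j G (y + t • basisVec j)) t := by
    have e1 : HasDerivAt (fun s : ℝ => y + s • (basisVec j : Plane)) (basisVec j) t := by
      simpa using ((hasDerivAt_id t).smul_const (basisVec j : Plane)).const_add y
    exact ((hG.differentiable (by norm_num) _).hasFDerivAt).comp_hasDerivAt t e1
  have h3 := hd.eventually_ne (c := c) h2
  rw [eventually_nhdsWithin_iff] at h3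
  filter_upwards [mem_nhdsWithin_of_mem_nhds h3, self_mem_nhdsWithin] with s hs1 hs2
  by_contra hne
  exact hs1 hne (Classical.not_imp.1 hs2).1

/-- A function with `θ' = 0` near zero and `θ' → 1` elsewhere as `n → ∞`. -/
def ramp (n : ℕ) (s : ℝ) : ℝ := min 1 (max 0 (n * |s| - 1))

lemma continuous_ramp (n : ℕ) : Continuous (ramp n) := by unfold ramp; fun_prop

lemma abs_ramp_le (n : ℕ) (s : ℝ) : |ramp n s| ≤ 1 := by
  rw [abs_of_nonneg (le_min zero_le_one (le_max_left _ _))]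
  exact min_le_left _ _

lemma ramp_eq_zero {n : ℕ} {s : ℝ} (h : n * |s| ≤ 1) : ramp n s = 0 := by
  unfold ramp
  rw [max_eq_left (by linarith), min_eq_right zero_le_one]

lemma tendsto_ramp {s : ℝ} (hs : s ≠ 0) : Tendsto (fun n => ramp n s) atTop (𝓝 1) := by
  refine tendsto_const_nhds.congr' ?_
  have h : Tendsto (fun n : ℕ => (n : ℝ) * |s|) atTop atTop :=
    tendsto_natCast_atTop_atTop.atTop_mul_const (abs_pos.2 hs)
  filter_upwards [h.eventually_ge_atTop 2] with n hn
  unfold ramp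
  rw [min_eq_left]
  exact le_max_of_le_right (by linarith)

/-- The primitive of `ramp n`, a cutoff of the identity near zero. -/
def rampPrimitive (n : ℕ) (s : ℝ) : ℝ := ∫ t in (0 : ℝ)..s, ramp n t

lemma hasDerivAt_rampPrimitive (n : ℕ) (s : ℝ) : HasDerivAt (rampPrimitive n) (ramp n s) s :=
  intervalIntegral.integral_hasDerivAt_right ((continuous_ramp n).intervalIntegrable _ _)
    ((continuous_ramp n).stronglyMeasurableAtFilter _ _) (continuous_ramp n).continuousAt

lemma contDiff_rampPrimitive (n : ℕ) : ContDiff ℝ 1 (rampPrimitive n) := by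
  rw [contDiff_one_iff_deriv]
  refine ⟨fun s => (hasDerivAt_rampPrimitive n s).differentiableAt, ?_⟩
  rw [funext fun s => (hasDerivAt_rampPrimitive n s).deriv]
  exact continuous_ramp n

lemma rampPrimitive_eq_zero {n : ℕ} {s : ℝ} (h : n * |s| ≤ 1) : rampPrimitive n s = 0 := by
  refine intervalIntegral.integral_zero_ae (ae_of_all _ fun t ht => ramp_eq_zero ?_)
  refine le_trans (mul_le_mul_of_nonneg_left ?_ (Nat.cast_nonneg n)) h
  rcases Set.mem_uIoc.1 ht with ⟨h1, h2⟩ | ⟨h1, h2⟩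
  · rw [abs_of_pos h1]; exact h2.trans (le_abs_self s)
  · rw [abs_of_nonpos h2, abs_of_neg (h1.trans_le h2)]; linarith

/-- The Jacobian of a pair of functions one of which has a limit at infinity integrates to zero. -/
theorem integral_jac_eq_zero {G H : Plane → ℝ} {c : ℝ} (hG : ContDiff ℝ 1 G)
    (hlim : Tendsto G (cocompact Plane) (𝓝 c)) (hH : ContDiff ℝ 2 H)
    (hint : Integrable (jac G H)) : ∫ x, jac G H x = 0 := by
  have hpd : ∀ n j x, pd j (fun y => rampPrimitive n (G y - c)) x
      = ramp n (G x - c) * pd j G x := by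
    intro n j x
    have h1 := (hasDerivAt_rampPrimitive n (G x - c)).comp_hasFDerivAt x
      ((hG.differentiable (by norm_num) x).hasFDerivAt.sub_const c)
    change fderiv ℝ (rampPrimitive n ∘ fun y => G y - c) x (basisVec j) = _
    rw [h1.fderiv]
    simp [pd]
  have hjac : ∀ n x, jac (fun y => rampPrimitive n (G y - c)) H x
      = ramp n (G x - c) * jac G H x := by
    intro n x
    simp only [jac, hpd]
    ring
  have hzero : ∀ n : ℕ, ∫ x, ramp n (G x - c) * jac G H x = 0 := by
    intro n
    simp_rw [← hjac]
    refine integral_jac_of_hasCompactSupport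
      ((contDiff_rampPrimitive n).comp (hG.sub contDiff_const)) ?_ hH
    rw [hasCompactSupport_iff_eventuallyEq]
    have h2 : Tendsto (fun x => (n : ℝ) * |G x - c|) (coclosedCompact Plane) (𝓝 0) := by
      have h3 : Tendsto (fun x => (n : ℝ) * |G x - c|) (cocompact Plane) (𝓝 (n * |c - c|)) :=
        ((hlim.sub_const c).abs).const_mul _
      rw [coclosedCompact_eq_cocompact]
      simpa using h3
    -- Near infinity `|G - c|` drops below the threshold under which the cutoff vanishes; this gives
    -- compact support.
    filter_upwards [h2.eventually (eventually_le_nhds zero_lt_one)] with x hx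
    exact rampPrimitive_eq_zero hx
  have hconv : Tendsto (fun n : ℕ => ∫ x, ramp n (G x - c) * jac G H x) atTop
      (𝓝 (∫ x, jac G H x)) := by
    refine tendsto_integral_of_dominated_convergence (fun x => |jac G H x|) (fun n => ?_)
      hint.abs (fun n => ?_) ?_
    · exact (((continuous_ramp n).comp (hG.continuous.sub continuous_const)).mul
        (continuous_jac hG (hH.of_le (by norm_num)))).aestronglyMeasurable
    · refine ae_of_all _ fun x => ?_
      rw [Real.norm_eq_abs, abs_mul]
      exact mul_le_of_le_one_left (abs_nonneg _) (abs_ramp_le _ _)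
    -- On the level set `G = c` the ramp stays 0, but there the Jacobian itself vanishes almost
    -- everywhere.
    · filter_upwards [ae_pd_eq_zero_of_eq hG c 0, ae_pd_eq_zero_of_eq hG c 1] with x h0 h1
      by_cases hx : G x = c
      · simp [jac, h0 hx, h1 hx]
      · simpa using (tendsto_ramp (sub_ne_zero.2 hx)).mul_const (jac G H x)
  simp_rw [hzero] at hconv
  exact (tendsto_nhds_unique hconv tendsto_const_nhds)

/-! ### Rotation-invariant functionals on the sphere -/

open MvPolynomial in
/-- A linear functional on polynomials which is killed by infinitesimal rotations, does not see
multiplication by the square of the radius, and vanishes at `1`, is zero. -/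
theorem eq_zero_of_rotation_moments (F : MvPolynomial (Fin 3) ℝ →ₗ[ℝ] ℝ)
    (h01 : ∀ p, F (X 0 * pderiv 1 p - X 1 * pderiv 0 p) = 0)
    (h12 : ∀ p, F (X 1 * pderiv 2 p - X 2 * pderiv 1 p) = 0)
    (hr : ∀ p, F ((X 0 ^ 2 + X 1 ^ 2 + X 2 ^ 2) * p) = F p) (h1 : F 1 = 0) : F = 0 := by
  let M : ℕ → ℕ → ℕ → MvPolynomial (Fin 3) ℝ := fun a b c => X 0 ^ a * X 1 ^ b * X 2 ^ c
  have hM : ∀ a b c, M a b c = X 0 ^ a * X 1 ^ b * X 2 ^ c := fun _ _ _ => rfl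
  have smulF : ∀ (k : ℕ) p, F ((k : MvPolynomial (Fin 3) ℝ) * p) = k * F p := by
    intro k p
    rw [← nsmul_eq_mul, map_nsmul, nsmul_eq_mul]
  -- Rotation relations kill monomials with an exponent one (`a1`, `b1`) and trade two powers of one
  -- variable for two of the next (`a2`, `b2`).
  have a1 : ∀ b c, F (M 1 b c) = 0 := by
    intro b c
    have h := h01 (M 0 (b + 1) c)
    have e : X 0 * pderiv 1 (M 0 (b + 1) c) - X 1 * pderiv 0 (M 0 (b + 1) c)
        = ((b + 1 : ℕ) : MvPolynomial (Fin 3) ℝ) * M 1 b c := by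
      simp [hM, Derivation.leibniz, Derivation.leibniz_pow, pderiv_X]
      ring
    rw [e, smulF] at h
    exact (mul_eq_zero.1 h).resolve_left (by positivity)
  have a2 : ∀ a b c, ((b + 1 : ℕ) : ℝ) * F (M (a + 2) b c) = (a + 1 : ℕ) * F (M a (b + 2) c) := by
    intro a b c
    have h := h01 (M (a + 1) (b + 1) c)
    have e : X 0 * pderiv 1 (M (a + 1) (b + 1) c) - X 1 * pderiv 0 (M (a + 1) (b + 1) c)
        = ((b + 1 : ℕ) : MvPolynomial (Fin 3) ℝ) * M (a + 2) b c
          - ((a + 1 : ℕ) : MvPolynomial (Fin 3) ℝ) * M a (b + 2) c := by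
      simp [hM, Derivation.leibniz, Derivation.leibniz_pow, pderiv_X]
      ring
    rw [e, map_sub, smulF, smulF] at h
    exact sub_eq_zero.1 h
  have b1 : ∀ a c, F (M a 1 c) = 0 := by
    intro a c
    have h := h12 (M a 0 (c + 1))
    have e : X 1 * pderiv 2 (M a 0 (c + 1)) - X 2 * pderiv 1 (M a 0 (c + 1))
        = ((c + 1 : ℕ) : MvPolynomial (Fin 3) ℝ) * M a 1 c := by
      simp [hM, Derivation.leibniz, Derivation.leibniz_pow, pderiv_X]
      ring
    rw [e, smulF] at h
    exact (mul_eq_zero.1 h).resolve_left (by positivity)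
  have b2 : ∀ a b c, ((c + 1 : ℕ) : ℝ) * F (M a (b + 2) c) = (b + 1 : ℕ) * F (M a b (c + 2)) := by
    intro a b c
    have h := h12 (M a (b + 1) (c + 1))
    have e : X 1 * pderiv 2 (M a (b + 1) (c + 1)) - X 2 * pderiv 1 (M a (b + 1) (c + 1))
        = ((c + 1 : ℕ) : MvPolynomial (Fin 3) ℝ) * M a (b + 2) c
          - ((b + 1 : ℕ) : MvPolynomial (Fin 3) ℝ) * M a b (c + 2) := by
      simp [hM, Derivation.leibniz, Derivation.leibniz_pow, pderiv_X]
      ring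
    rw [e, map_sub, smulF, smulF] at h
    exact sub_eq_zero.1 h
  have c1 : F (M 0 0 1) = 0 := by
    have h := h12 (M 0 1 0)
    have e : X 1 * pderiv 2 (M 0 1 0) - X 2 * pderiv 1 (M 0 1 0) = - M 0 0 1 := by
      simp [hM, pderiv_X]
    rw [e, map_neg] at h
    exact neg_eq_zero.1 h
  have r : ∀ a b c, F (M (a + 2) b c) + F (M a (b + 2) c) + F (M a b (c + 2)) = F (M a b c) := by
    intro a b c
    rw [← hr (M a b c), ← map_add, ← map_add]
    congr 1
    simp only [hM]
    ring
  have z0 : ∀ c, F (M 0 0 c) = 0 := by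
    intro c
    induction c using Nat.twoStepInduction with
    | zero => simpa [hM] using h1
    | one => exact c1
    | more c ih _ =>
      have e1 := r 0 0 c
      have e2 := a2 0 0 c
      have e3 := b2 0 0 c
      rw [ih] at e1
      push_cast at e2 e3
      -- By `e2` and `e3` the other two terms of the radius relation are each `1/(c + 1)` times `F
      -- (M 0 0 (c + 2))`.
      have e4 : ((c : ℝ) + 3) * F (M 0 0 (c + 2)) = 0 := by
        linear_combination ((c : ℝ) + 1) * e1 - ((c : ℝ) + 1) * e2 - 2 * e3
      exact (mul_eq_zero.1 e4).resolve_left (by positivity)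
  have z1 : ∀ b c, F (M 0 b c) = 0 := by
    intro b
    induction b using Nat.twoStepInduction with
    | zero => exact z0
    | one => exact b1 0
    | more b ih _ =>
      intro c
      have e := b2 0 b c
      rw [ih, mul_zero] at e
      exact (mul_eq_zero.1 e).resolve_left (by positivity)
  have z2 : ∀ a b c, F (M a b c) = 0 := by
    intro a
    induction a using Nat.twoStepInduction with
    | zero => exact z1
    | one => exact a1
    | more a ih _ =>
      intro b c
      have e := a2 a b c
      rw [ih, mul_zero] at e
      exact (mul_eq_zero.1 e).resolve_left (by positivity)
  have e : ∀ s : Fin 3 →₀ ℕ, F (monomial s 1) = 0 := by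
    intro s
    rw [monomial_eq, Finsupp.prod_fintype _ _ (fun i => pow_zero _), Fin.prod_univ_three]
    simpa [hM] using z2 (s 0) (s 1) (s 2)
  exact LinearMap.ext fun p => by
    rw [p.as_sum, map_sum]
    refine Finset.sum_eq_zero fun s _ => ?_
    rw [← mul_one (coeff s p), ← smul_eq_mul, ← smul_monomial, map_smul, e, smul_zero]

/-- The infinitesimal rotation about the axis `a`. -/
def rotField (a : Iso) : Iso →L[ℝ] Iso :=
  LinearMap.toContinuousLinearMap
    ((WithLp.linearEquiv 2 ℝ (Fin 3 → ℝ)).symm.toLinearMap ∘ₗ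
      crossProduct a.ofLp ∘ₗ (WithLp.linearEquiv 2 ℝ (Fin 3 → ℝ)).toLinearMap)

lemma rotField_ofLp (a m : Iso) : (rotField a m).ofLp = a.ofLp ⨯₃ m.ofLp := rfl

lemma inner_eq_dotProduct (a b : Iso) : inner ℝ a b = a.ofLp ⬝ᵥ b.ofLp := by
  rw [EuclideanSpace.inner_eq_star_dotProduct, dotProduct_comm]
  simp

lemma hasFDerivAt_eval (p : MvPolynomial (Fin 3) ℝ) (m : Iso) :
    HasFDerivAt (fun y : Iso => MvPolynomial.eval y.ofLp p)
      (∑ i, MvPolynomial.eval m.ofLp (MvPolynomial.pderiv i p) • EuclideanSpace.proj (𝕜 := ℝ) i)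
      m := by
  induction p using MvPolynomial.induction_on with
  | C c => simpa using hasFDerivAt_const c m
  | add p q hp hq =>
    simp only [map_add, add_smul, Finset.sum_add_distrib]
    exact hp.add hq
  | mul_X p i hp =>
    have hX : HasFDerivAt (fun y : Iso => y.ofLp i) (EuclideanSpace.proj (𝕜 := ℝ) i) m :=
      (EuclideanSpace.proj (𝕜 := ℝ) (ι := Fin 3) i).hasFDerivAt
    have h := hp.mul hX
    simp only [map_mul, MvPolynomial.eval_X]
    refine h.congr_fderiv ?_
    ext v
    simp [Derivation.leibniz, MvPolynomial.pderiv_X, Pi.single_apply, add_mul, Finset.sum_add_distrib,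
      apply_ite, Finset.mul_sum]
    exact Finset.sum_congr rfl fun _ _ => by ring

lemma contDiff_eval (p : MvPolynomial (Fin 3) ℝ) :
    ContDiff ℝ ∞ (fun y : Iso => MvPolynomial.eval y.ofLp p) := by
  induction p using MvPolynomial.induction_on with
  | C c => simpa using contDiff_const
  | add p q hp hq => simpa using hp.add hq
  | mul_X p i hp =>
    have hX : ContDiff ℝ ∞ (fun y : Iso => y.ofLp i) :=
      (EuclideanSpace.proj (𝕜 := ℝ) (ι := Fin 3) i).contDiff
    simpa using hp.mul hX

/-- The derivative of a smooth function on isospace along the rotation field with axis `a`,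
restricted to the unit sphere. -/
def rotDeriv (a : Iso) (g : Iso → ℝ) (hg : ContDiff ℝ ∞ g) : C(S2, ℝ) where
  toFun m := fderiv ℝ g m (rotField a m)
  continuous_toFun :=
    ((hg.continuous_fderiv (by simp)).comp continuous_subtype_val).clm_apply
      ((rotField a).continuous.comp continuous_subtype_val)

/-- A coordinate function on the unit sphere. -/
def coordFun (i : Fin 3) : C(S2, ℝ) where
  toFun m := (m : Iso).ofLp i
  continuous_toFun := by fun_prop

lemma aeval_coordFun (p : MvPolynomial (Fin 3) ℝ) (m : S2) :
    MvPolynomial.aeval coordFun p m = MvPolynomial.eval (m : Iso).ofLp p := by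
  induction p using MvPolynomial.induction_on with
  | C c => simp
  | add p q hp hq => simp [hp, hq]
  | mul_X p i hp => simp [hp, coordFun]

/-- Stone-Weierstrass: the coordinates separate points. -/
lemma topologicalClosure_range_aeval_coordFun :
    (MvPolynomial.aeval (R := ℝ) coordFun).range.topologicalClosure = ⊤ := by
  refine ContinuousMap.subalgebra_topologicalClosure_eq_top_of_separatesPoints _ ?_
  intro m n hmn
  obtain ⟨i, hi⟩ : ∃ i, (m : Iso).ofLp i ≠ (n : Iso).ofLp i := by
    by_contra! h
    exact hmn (Subtype.ext (PiLp.ext h))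
  exact ⟨coordFun i, ⟨coordFun i, ⟨MvPolynomial.X i, by simp⟩, rfl⟩, hi⟩

/-- A rotation invariant continuous functional which vanishes at `1` is zero. -/
theorem eq_zero_of_rotDeriv (D : C(S2, ℝ) →L[ℝ] ℝ)
    (hD : ∀ a g hg, D (rotDeriv a g hg) = 0) (h1 : D 1 = 0) : D = 0 := by
  let F : MvPolynomial (Fin 3) ℝ →ₗ[ℝ] ℝ :=
    D.toLinearMap ∘ₗ (MvPolynomial.aeval (R := ℝ) coordFun).toLinearMap
  have hF : F = 0 := by
    refine eq_zero_of_rotation_moments F (fun p => ?_) (fun p => ?_) (fun p => ?_) ?_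
    -- The field `e₂ × m = (-m₁, m₀, 0)` differentiates polynomials by `X₀∂₁ - X₁∂₀`.
    · rw [← hD (basisVec 2) _ (contDiff_eval p)]
      refine congrArg D (ContinuousMap.ext fun m => ?_)
      change MvPolynomial.aeval coordFun _ m
        = fderiv ℝ (fun y : Iso => MvPolynomial.eval y.ofLp p) m (rotField (basisVec 2) m)
      rw [aeval_coordFun, (hasFDerivAt_eval p m).fderiv]
      simp [Fin.sum_univ_three, rotField_ofLp, cross_apply, basisVec]
      ring
    · rw [← hD (basisVec 0) _ (contDiff_eval p)]
      refine congrArg D (ContinuousMap.ext fun m => ?_)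
      change MvPolynomial.aeval coordFun _ m
        = fderiv ℝ (fun y : Iso => MvPolynomial.eval y.ofLp p) m (rotField (basisVec 0) m)
      rw [aeval_coordFun, (hasFDerivAt_eval p m).fderiv]
      simp [Fin.sum_univ_three, rotField_ofLp, cross_apply, basisVec]
      ring
    · refine congrArg D (ContinuousMap.ext fun m => ?_)
      have hm : (m : Iso).ofLp 0 ^ 2 + (m : Iso).ofLp 1 ^ 2 + (m : Iso).ofLp 2 ^ 2 = 1 := by
        have h := EuclideanSpace.norm_sq_eq (m : Iso)
        rw [norm_eq_of_mem_sphere m] at h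
        simpa [Fin.sum_univ_three] using h.symm
      change MvPolynomial.aeval coordFun _ m = MvPolynomial.aeval coordFun _ m
      rw [aeval_coordFun, aeval_coordFun]
      simp [hm]
    · simpa [F] using h1
  have hclosed : IsClosed {f : C(S2, ℝ) | D f = 0} := isClosed_eq D.continuous continuous_const
  ext f
  have hf : f ∈ (MvPolynomial.aeval (R := ℝ) coordFun).range.topologicalClosure := by
    rw [topologicalClosure_range_aeval_coordFun]; trivial
  refine closure_minimal ?_ hclosed hf
  rintro _ ⟨p, rfl⟩
  exact LinearMap.congr_fun hF p

/-! ### Rotations and invariance of the area measure -/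

lemma skewAdjoint_rotField (a : Iso) : rotField a ∈ skewAdjoint (Iso →L[ℝ] Iso) := by
  rw [skewAdjoint.mem_iff, ContinuousLinearMap.star_eq_adjoint, eq_comm,
    ContinuousLinearMap.eq_adjoint_iff]
  intro x y
  simp only [neg_apply, inner_neg_left, inner_eq_dotProduct, rotField_ofLp]
  simp only [cross_apply, dotProduct, Fin.sum_univ_three, Matrix.cons_val]
  ring

lemma exp_rotField_mem_unitary (a : Iso) (t : ℝ) :
    NormedSpace.exp (t • rotField a) ∈ unitary (Iso →L[ℝ] Iso) := by
  let +nondep : NormedAlgebra ℚ (Iso →L[ℝ] Iso) := .restrictScalars ℚ ℝ _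
  exact NormedSpace.exp_mem_unitary_of_mem_skewAdjoint
    (skewAdjoint.smul_mem t (skewAdjoint_rotField a))

/-- The rotation about the axis `a` by the angle `t`. -/
def rot (a : Iso) (t : ℝ) : Iso ≃ₗᵢ[ℝ] Iso :=
  Unitary.linearIsometryEquiv ⟨NormedSpace.exp (t • rotField a), exp_rotField_mem_unitary a t⟩

lemma rot_apply (a : Iso) (t : ℝ) (m : Iso) : rot a t m = NormedSpace.exp (t • rotField a) m := rfl

lemma rot_zero (a m : Iso) : rot a 0 m = m := by
  rw [rot_apply, zero_smul ℝ (rotField a)]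
  let +nondep : NormedAlgebra ℚ (Iso →L[ℝ] Iso) := .restrictScalars ℚ ℝ _
  rw [NormedSpace.exp_zero]
  rfl

lemma hasDerivAt_rot (a m : Iso) (t : ℝ) :
    HasDerivAt (fun s => rot a s m) (rotField a (rot a t m)) t := by
  have h := hasDerivAt_exp_smul_const' (𝕂 := ℝ) (rotField a) t
  exact (ContinuousLinearMap.apply ℝ Iso m).hasFDerivAt.comp_hasDerivAt t h

/-- A linear isometry restricts to the unit sphere. -/
def sphereMap (R : Iso ≃ₗᵢ[ℝ] Iso) (m : S2) : S2 := ⟨R m, by simp⟩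

lemma continuous_sphereMap (R : Iso ≃ₗᵢ[ℝ] Iso) : Continuous (sphereMap R) :=
  (R.continuous.comp continuous_subtype_val).subtype_mk _

-- The area of `s` is a constant times the volume of the cone `(0,1) • s`, and a linear isometry
-- carries cones to cones, preserving volume.
open scoped Pointwise in
lemma measurePreserving_sphereMap (R : Iso ≃ₗᵢ[ℝ] Iso) :
    MeasurePreserving (sphereMap R) (volume : Measure Iso).toSphere
      (volume : Measure Iso).toSphere := by
  refine ⟨(continuous_sphereMap R).measurable, ?_⟩
  ext s hs
  rw [Measure.map_apply (continuous_sphereMap R).measurable hs,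
    Measure.toSphere_apply' _ ((continuous_sphereMap R).measurable hs),
    Measure.toSphere_apply' _ hs]
  congr 1
  have h : Set.Ioo (0 : ℝ) 1 • ((↑) '' (sphereMap R ⁻¹' s) : Set Iso)
      = R ⁻¹' (Set.Ioo (0 : ℝ) 1 • ((↑) '' s : Set Iso)) := by
    ext x
    simp only [Set.mem_smul, Set.mem_preimage, Set.mem_image]
    constructor
    · rintro ⟨r, hr, _, ⟨m, hm, rfl⟩, rfl⟩
      exact ⟨r, hr, _, ⟨_, hm, rfl⟩, by simp [sphereMap]⟩
    · rintro ⟨r, hr, _, ⟨m, hm, rfl⟩, h⟩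
      refine ⟨r, hr, R.symm m, ⟨sphereMap R.symm m, ?_, rfl⟩, ?_⟩
      · have : sphereMap R (sphereMap R.symm m) = m := Subtype.ext (by simp [sphereMap])
        rwa [this]
      · rw [← map_smul, h, R.symm_apply_apply]
  rw [h]
  exact R.measurePreserving.measure_preimage_equiv (f := R.toHomeomorph.toMeasurableEquiv) _

/-- The integral of `g` over the sphere after rotation by `t` is constant in `t`; this is its
derivative at `t = 0`. Since the derivative at any `t` is `rotDeriv` at the rotated point, one bound
on the sphere dominates for all `t`. -/
lemma integral_rotDeriv_toSphere (a : Iso) (g : Iso → ℝ) (hg : ContDiff ℝ ∞ g) :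
    ∫ m, rotDeriv a g hg m ∂(volume : Measure Iso).toSphere = 0 := by
  obtain ⟨C, hC⟩ := isCompact_univ.exists_bound_of_continuousOn (rotDeriv a g hg).continuous.continuousOn
  have hcont : ∀ t : ℝ, Continuous fun m : S2 => g (rot a t m) := fun t =>
    hg.continuous.comp ((rot a t).continuous.comp continuous_subtype_val)
  have h := (hasDerivAt_integral_of_dominated_loc_of_deriv_le (s := Set.univ)
    (μ := (volume : Measure Iso).toSphere)
    (F := fun (t : ℝ) (m : S2) => g (rot a t m))
    (F' := fun t m => rotDeriv a g hg (sphereMap (rot a t) m)) (bound := fun _ => C) (x₀ := (0 : ℝ))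
    Filter.univ_mem (.of_forall fun t => (hcont t).aestronglyMeasurable)
    ((hcont 0).integrable_of_hasCompactSupport (HasCompactSupport.of_compactSpace _))
    (((rotDeriv a g hg).continuous.comp (continuous_sphereMap _)).aestronglyMeasurable)
    (ae_of_all _ fun m t _ => hC _ trivial) (integrable_const _)
    (ae_of_all _ fun m t _ => ?_)).2
  · have hconst : ∀ t : ℝ, ∫ m : S2, g (rot a t m) ∂(volume : Measure Iso).toSphere
        = ∫ m : S2, g m ∂(volume : Measure Iso).toSphere := by
      intro t
      have hp := measurePreserving_sphereMap (rot a t)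
      conv_rhs => rw [← hp.map_eq]
      exact (integral_map (f := fun m : S2 => g m) hp.measurable.aemeasurable
        (hg.continuous.comp continuous_subtype_val).aestronglyMeasurable).symm
    simp_rw [hconst] at h
    have h0 := h.unique (hasDerivAt_const _ _)
    have e : ∀ m : S2, sphereMap (rot a 0) m = m := fun m =>
      Subtype.ext (by simp [sphereMap, rot_zero])
    simpa [e] using h0
  · exact (hg.differentiable (by simp) _).hasFDerivAt.comp_hasDerivAt t (hasDerivAt_rot a m t)

/-! ### The charge density as a pulled-back area form -/

lemma triple_apply (a b c : Iso) :
    triple a b c = a.ofLp 0 * (b.ofLp 1 * c.ofLp 2 - b.ofLp 2 * c.ofLp 1)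
      + a.ofLp 1 * (b.ofLp 2 * c.ofLp 0 - b.ofLp 0 * c.ofLp 2)
      + a.ofLp 2 * (b.ofLp 0 * c.ofLp 1 - b.ofLp 1 * c.ofLp 0) := by
  simp only [triple, cross_apply, dotProduct, Fin.sum_univ_three, Matrix.cons_val]

lemma contDiff_triple : ContDiff ℝ ∞ fun p : Iso × Iso × Iso => triple p.1 p.2.1 p.2.2 := by
  have h : ∀ k : Fin 3, ContDiff ℝ ∞ fun m : Iso => m.ofLp k := fun k =>
    (EuclideanSpace.proj (𝕜 := ℝ) (ι := Fin 3) k).contDiff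
  have ha := fun k => (h k).comp (contDiff_fst (𝕜 := ℝ) (E := Iso) (F := Iso × Iso) (n := ∞))
  have hb := fun k => (h k).comp
    (contDiff_fst.comp (contDiff_snd (𝕜 := ℝ) (E := Iso) (F := Iso × Iso) (n := ∞)))
  have hc := fun k => (h k).comp
    (contDiff_snd.comp (contDiff_snd (𝕜 := ℝ) (E := Iso) (F := Iso × Iso) (n := ∞)))
  simp only [triple_apply]
  exact (((ha 0).mul (((hb 1).mul (hc 2)).sub ((hb 2).mul (hc 1)))).add
    ((ha 1).mul (((hb 2).mul (hc 0)).sub ((hb 0).mul (hc 2))))).add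
    ((ha 2).mul (((hb 0).mul (hc 1)).sub ((hb 1).mul (hc 0))))

lemma continuous_triple : Continuous fun p : Iso × Iso × Iso => triple p.1 p.2.1 p.2.2 :=
  contDiff_triple.continuous

lemma triple_swap (m u v : Iso) : triple m v u = - triple m u v := by
  simp only [triple, ← cross_anticomm u.ofLp v.ofLp, dotProduct_neg]

lemma chargeJet_eq (m : Iso) (v : Fin 2 → Iso) :
    chargeJet m v = 1 / (4 * Real.pi) * triple m (v 0) (v 1) := by
  have := Real.pi_ne_zero
  rw [chargeJet, triple_swap m (v 0) (v 1)]
  field_simp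
  ring

/-- Contraction of the area form of the unit sphere with a rotation field. -/
lemma triple_smul_rotField {m u v : Iso} (a : Iso) (hm : ‖m‖ = 1) (hu : inner ℝ m u = 0)
    (hv : inner ℝ m v = 0) :
    triple m u v • rotField a m = inner ℝ a v • u - inner ℝ a u • v := by
  have hm' : m.ofLp ⬝ᵥ m.ofLp = 1 := by
    rw [← inner_eq_dotProduct, real_inner_self_eq_norm_sq, hm, one_pow]
  rw [inner_eq_dotProduct] at hu hv
  simp only [dotProduct, Fin.sum_univ_three] at hm' hu hv
  ext k
  simp only [PiLp.smul_apply, PiLp.sub_apply, rotField_ofLp, inner_eq_dotProduct, triple, smul_eq_mul]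
  -- For tangent `u`, `v` one has `u × v = triple m u v • m`, so the claim is the expansion of `a ×
  -- (u × v)`. Here it is a polynomial identity for all vectors, with the constraints on `m`, `u`,
  -- `v` as explicit error terms.
  have key : ∀ k, (m.ofLp ⬝ᵥ (u.ofLp ⨯₃ v.ofLp)) * (a.ofLp ⨯₃ m.ofLp) k
      - ((a.ofLp ⬝ᵥ v.ofLp) * u.ofLp k - (a.ofLp ⬝ᵥ u.ofLp) * v.ofLp k)
      = (a.ofLp ⨯₃ (u.ofLp ⨯₃ v.ofLp)) k * (m.ofLp ⬝ᵥ m.ofLp - 1)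
        + (a.ofLp ⨯₃ (m.ofLp ⨯₃ u.ofLp)) k * (m.ofLp ⬝ᵥ v.ofLp)
        - (a.ofLp ⨯₃ (m.ofLp ⨯₃ v.ofLp)) k * (m.ofLp ⬝ᵥ u.ofLp) := by
    intro k
    fin_cases k <;>
      simp only [cross_apply, dotProduct, Fin.sum_univ_three, Matrix.cons_val, Fin.zero_eta,
        Fin.mk_one, Fin.reduceFinMk] <;> ring
  have h := key k
  simp only [dotProduct, Fin.sum_univ_three, hm', hu, hv] at h ⊢
  linear_combination h

section Field

variable {φ : Plane → S2}

lemma hasFDerivAt_field (hφ : ContDiff ℝ 2 (fun x => (φ x : Iso))) (x : Plane) :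
    HasFDerivAt (fun x => (φ x : Iso)) (fderiv ℝ (fun x => (φ x : Iso)) x) x :=
  (hφ.differentiable (by norm_num) x).hasFDerivAt

lemma inner_pd_field (hφ : ContDiff ℝ 2 (fun x => (φ x : Iso))) (j : Fin 2) (x : Plane) :
    inner ℝ (φ x : Iso) (pd j (fun y => (φ y : Iso)) x) = 0 := by
  have h := (hasFDerivAt_field hφ x).norm_sq
  have hc : (fun y => ‖(φ y : Iso)‖ ^ 2) = fun _ => (1 : ℝ) := by
    funext y; rw [norm_eq_of_mem_sphere, one_pow]
  rw [hc] at h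
  have h2 := congrArg (fun L : Plane →L[ℝ] ℝ => L (basisVec j)) (h.unique (hasFDerivAt_const _ _))
  simpa [pd] using h2

lemma continuous_field (hφ : ContDiff ℝ 2 (fun x => (φ x : Iso))) : Continuous φ :=
  continuous_induced_rng.2 hφ.continuous

lemma continuous_chargeDensity (hφ : ContDiff ℝ 2 (fun x => (φ x : Iso))) :
    Continuous (chargeDensity φ) := by
  have h1 := continuous_pd (hφ.of_le (m := 1) (by norm_num))
  have e : chargeDensity φ = fun x => 1 / (4 * Real.pi) *
      triple (φ x) (pd 0 (fun y => (φ y : Iso)) x) (pd 1 (fun y => (φ y : Iso)) x) := by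
    funext x
    exact chargeJet_eq _ _
  rw [e]
  exact continuous_const.mul (continuous_triple.comp (hφ.continuous.prodMk ((h1 0).prodMk (h1 1))))

/-- Apply `dg` to `triple_smul_rotField` with `u`, `v` the partial derivatives of the field, which
are tangent to the sphere. -/
lemma rotDeriv_mul_chargeDensity (hφ : ContDiff ℝ 2 (fun x => (φ x : Iso))) (a : Iso)
    (g : Iso → ℝ) (hg : ContDiff ℝ ∞ g) (x : Plane) :
    rotDeriv a g hg (φ x) * chargeDensity φ x
      = 1 / (4 * Real.pi) * jac (fun y => g (φ y)) (fun y => inner ℝ a (φ y : Iso)) x := by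
  have hf := hasFDerivAt_field hφ x
  have hG : ∀ j, pd j (fun y => g (φ y)) x
      = fderiv ℝ g (φ x) (pd j (fun y => (φ y : Iso)) x) := by
    intro j
    have := ((hg.differentiable (by simp) (φ x : Iso)).hasFDerivAt.comp x hf).fderiv
    exact congrArg (fun L : Plane →L[ℝ] ℝ => L (basisVec j)) this
  have hH : ∀ j, pd j (fun y => inner ℝ a (φ y : Iso)) x
      = inner ℝ a (pd j (fun y => (φ y : Iso)) x) := by
    intro j
    have := ((innerSL ℝ a).hasFDerivAt.comp x hf).fderiv
    exact congrArg (fun L : Plane →L[ℝ] ℝ => L (basisVec j)) this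
  have key := congrArg (fderiv ℝ g (φ x)) (triple_smul_rotField a (norm_eq_of_mem_sphere (φ x))
    (inner_pd_field hφ 0 x) (inner_pd_field hφ 1 x))
  simp only [map_smul, map_sub, smul_eq_mul] at key
  have hr : rotDeriv a g hg (φ x) = fderiv ℝ g (φ x) (rotField a (φ x)) := rfl
  rw [jac, hG, hG, hH, hH, hr, chargeDensity, chargeJet_eq]
  linear_combination 1 / (4 * Real.pi) * key

end Field

/-! ### The degree formula -/

/-- Integration of continuous functions on the sphere, pulled back along a continuous map, against
an integrable weight. -/
def pullbackIntegral {X : Type*} [TopologicalSpace X] [MeasurableSpace X] [OpensMeasurableSpace X]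
    (μ : Measure X) {ψ : X → S2} (hψ : Continuous ψ) {w : X → ℝ} (hw : Integrable w μ) :
    C(S2, ℝ) →L[ℝ] ℝ :=
  have hint : ∀ f : C(S2, ℝ), Integrable (fun x => f (ψ x) * w x) μ := fun f =>
    hw.bdd_mul (c := ‖f‖) (by fun_prop) (ae_of_all _ fun x => f.norm_coe_le_norm (ψ x))
  LinearMap.mkContinuous
    { toFun := fun f => ∫ x, f (ψ x) * w x ∂μ
      map_add' := fun f g => by
        rw [← integral_add (hint f) (hint g)]
        simp [add_mul]
      map_smul' := fun c f => by
        rw [RingHom.id_apply, smul_eq_mul, ← integral_const_mul]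
        simp [mul_assoc] }
    (∫ x, |w x| ∂μ) fun f => by
      refine (norm_integral_le_integral_norm _).trans ?_
      rw [mul_comm, ← integral_const_mul]
      refine integral_mono (hint f).norm (hw.abs.const_mul _) fun x => ?_
      simp only [norm_mul]
      exact mul_le_mul_of_nonneg_right (f.norm_coe_le_norm _) (norm_nonneg _)

lemma pullbackIntegral_apply {X : Type*} [TopologicalSpace X] [MeasurableSpace X]
    [OpensMeasurableSpace X] (μ : Measure X) {ψ : X → S2} (hψ : Continuous ψ) {w : X → ℝ}
    (hw : Integrable w μ) (f : C(S2, ℝ)) :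
    pullbackIntegral μ hψ hw f = ∫ x, f (ψ x) * w x ∂μ := rfl

/-- The degree formula: the pull-back of a continuous function against the charge density only
sees the mean value of the function. -/
theorem integral_comp_mul_chargeDensity {φ : Plane → S2}
    (hφ : ContDiff ℝ 2 (fun x => (φ x : Iso))) {φinf : S2}
    (hlim : Tendsto φ (cocompact Plane) (𝓝 φinf)) (hB : Integrable (chargeDensity φ))
    (f : C(S2, ℝ)) :
    ∫ x, f (φ x) * chargeDensity φ x
      = charge φ * ⨍ m, f m ∂(volume : Measure Iso).toSphere := by
  set μ : Measure S2 := (volume : Measure Iso).toSphere with hμ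
  have hφc := continuous_field hφ
  let Λ := pullbackIntegral volume hφc hB
  let M := pullbackIntegral μ continuous_id (integrable_const (1 : ℝ))
  have hM : ∀ f : C(S2, ℝ), M f = ∫ m, f m ∂μ := fun f => by
    simp [M, pullbackIntegral_apply]
  have hpos : μ.real Set.univ ≠ 0 := by
    have : μ ≠ 0 := Measure.toSphere_ne_zero _
    simpa [measureReal_eq_zero_iff] using this
  -- The coefficient is forced by `D 1 = 0`.
  let D := Λ - (charge φ * (μ.real Set.univ)⁻¹) • M
  have hDapp : ∀ f, D f = (∫ x, f (φ x) * chargeDensity φ x)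
      - charge φ * (μ.real Set.univ)⁻¹ * ∫ m, f m ∂μ := fun f => by
    rw [← hM]; rfl
  have hD : D = 0 := by
    refine eq_zero_of_rotDeriv D (fun a g hg => ?_) ?_
    · rw [hDapp, hμ, integral_rotDeriv_toSphere, mul_zero, sub_zero]
      simp_rw [rotDeriv_mul_chargeDensity hφ]
      rw [integral_const_mul]
      have hG : ContDiff ℝ 1 fun y => g (φ y) :=
        (hg.of_le (by simp)).comp (hφ.of_le (by norm_num))
      have hJ : Integrable (jac (fun y => g (φ y)) fun y => inner ℝ a (φ y : Iso)) := by
        have h := (hB.bdd_mul (c := ‖rotDeriv a g hg‖)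
          (f := fun x => rotDeriv a g hg (φ x)) (by fun_prop)
          (ae_of_all _ fun x => (rotDeriv a g hg).norm_coe_le_norm (φ x))).const_mul (4 * Real.pi)
        refine h.congr (ae_of_all _ fun x => ?_)
        have := Real.pi_ne_zero
        simp only [rotDeriv_mul_chargeDensity hφ]
        field_simp
      rw [integral_jac_eq_zero hG (c := g φinf) ?_ (contDiff_const.inner ℝ hφ) hJ, mul_zero]
      exact ((hg.continuous.comp continuous_subtype_val).tendsto φinf).comp hlim
    · rw [hDapp]
      simp [charge, hpos]
  have h := hDapp f
  rw [hD, zero_apply, eq_comm, sub_eq_zero] at h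
  rw [h, average_eq, smul_eq_mul, mul_assoc]

/-! ### The energy bound and its saturation -/

lemma density_eq_sq (lam mu s b : ℝ) {u : ℝ} (hu : 0 ≤ u) :
    density lam mu s b u = (lam * b - mu * √u - s) ^ 2 + 2 * lam * mu * (b * √u) := by
  have h := Real.sq_sqrt hu
  unfold density
  linear_combination (-mu ^ 2) * h

section Energy

variable {lam mu : ℝ} {U : S2 → ℝ} {σ : Plane → ℝ} {φ : Plane → S2}

lemma energyDensity_eq (hU0 : ∀ m, 0 ≤ U m) (x : Plane) :
    energyDensity lam mu U σ φ x
      = bogomolnyi lam mu U σ φ x ^ 2 + 2 * lam * mu * (chargeDensity φ x * √(U (φ x))) :=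
  density_eq_sq _ _ _ _ (hU0 _)

lemma integrable_chargeDensity_mul_sqrt (hU : Continuous U)
    (hφ : ContDiff ℝ 2 (fun x => (φ x : Iso))) (hB : Integrable (chargeDensity φ)) :
    Integrable fun x => chargeDensity φ x * √(U (φ x)) := by
  have hφc := continuous_field hφ
  let f : C(S2, ℝ) := ⟨fun m => √(U m), hU.sqrt⟩
  exact hB.mul_bdd (c := ‖f‖) (hU.comp hφc).sqrt.aestronglyMeasurable
    (ae_of_all _ fun x => f.norm_coe_le_norm (φ x))

theorem integral_chargeDensity_mul_sqrt (hU : Continuous U)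
    (hφ : ContDiff ℝ 2 (fun x => (φ x : Iso))) {φinf : S2}
    (hlim : Tendsto φ (cocompact Plane) (𝓝 φinf)) (hB : Integrable (chargeDensity φ)) :
    ∫ x, chargeDensity φ x * √(U (φ x)) = charge φ * avgSqrt U := by
  have h := integral_comp_mul_chargeDensity hφ hlim hB ⟨fun m => √(U m), hU.sqrt⟩
  simp_rw [mul_comm (chargeDensity φ _)]
  exact h

lemma integrable_bogomolnyi_sq (hU : Continuous U) (hU0 : ∀ m, 0 ≤ U m)
    (hφ : ContDiff ℝ 2 (fun x => (φ x : Iso))) (hB : Integrable (chargeDensity φ))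
    (hE : Integrable (energyDensity lam mu U σ φ)) :
    Integrable fun x => bogomolnyi lam mu U σ φ x ^ 2 := by
  refine (hE.sub ((integrable_chargeDensity_mul_sqrt hU hφ hB).const_mul (2 * lam * mu))).congr
    (ae_of_all _ fun x => ?_)
  simp only [Pi.sub_apply, energyDensity_eq hU0]
  ring

theorem energy_eq (hU : Continuous U) (hU0 : ∀ m, 0 ≤ U m)
    (hφ : ContDiff ℝ 2 (fun x => (φ x : Iso))) (hB : Integrable (chargeDensity φ))
    (hE : Integrable (energyDensity lam mu U σ φ)) :
    energy lam mu U σ φ = (∫ x, bogomolnyi lam mu U σ φ x ^ 2)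
      + 2 * lam * mu * ∫ x, chargeDensity φ x * √(U (φ x)) := by
  rw [← integral_const_mul, ← integral_add (integrable_bogomolnyi_sq hU hU0 hφ hB hE)
    ((integrable_chargeDensity_mul_sqrt hU hφ hB).const_mul _)]
  exact integral_congr_ae (ae_of_all _ fun x => energyDensity_eq hU0 x)

lemma continuous_bogomolnyi (hU : Continuous U) (hσ : Continuous σ)
    (hφ : ContDiff ℝ 2 (fun x => (φ x : Iso))) : Continuous (bogomolnyi lam mu U σ φ) :=
  ((continuous_const.mul (continuous_chargeDensity hφ)).sub
    (continuous_const.mul (hU.comp (continuous_field hφ)).sqrt)).sub hσ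

theorem energy_eq_bound_iff (hU : Continuous U) (hU0 : ∀ m, 0 ≤ U m) (hσ : Continuous σ)
    (hφ : ContDiff ℝ 2 (fun x => (φ x : Iso))) {φinf : S2}
    (hlim : Tendsto φ (cocompact Plane) (𝓝 φinf)) (hB : Integrable (chargeDensity φ)) :
    (Integrable (energyDensity lam mu U σ φ) ∧
        energy lam mu U σ φ = 2 * lam * mu * charge φ * avgSqrt U) ↔
      ∀ x, bogomolnyi lam mu U σ φ x = 0 := by
  constructor
  · rintro ⟨hE, h⟩ x
    rw [energy_eq hU hU0 hφ hB hE, integral_chargeDensity_mul_sqrt hU hφ hlim hB, ← mul_assoc,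
      add_eq_right] at h
    rw [integral_eq_zero_iff_of_nonneg (fun x => sq_nonneg _)
      (integrable_bogomolnyi_sq hU hU0 hφ hB hE)] at h
    -- Lebesgue measure charges open sets, so a continuous function vanishing almost everywhere
    -- vanishes everywhere.
    have h2 := (((continuous_bogomolnyi hU hσ hφ).pow 2).ae_eq_iff_eq volume continuous_const).1 h
    exact pow_eq_zero_iff two_ne_zero |>.1 (congrFun h2 x)
  · intro h
    -- Only the cross term `2λμ B₀√U` survives, and it is integrable because `√U` is bounded on the
    -- compact sphere.
    have hE : Integrable (energyDensity lam mu U σ φ) := by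
      refine ((integrable_chargeDensity_mul_sqrt hU hφ hB).const_mul (2 * lam * mu)).congr
        (ae_of_all _ fun x => ?_)
      simp [energyDensity_eq hU0, h]
    refine ⟨hE, ?_⟩
    rw [energy_eq hU hU0 hφ hB hE, integral_chargeDensity_mul_sqrt hU hφ hlim hB]
    simp [h, mul_assoc]

end Energy

/-! ### Null Lagrangians and the Euler-Lagrange equations -/

/-- The determinant of a pair of vectors of the plane. -/
def det2 (P : Fin 2 → Plane) : ℝ := P 0 0 * P 1 1 - P 0 1 * P 1 0

/-- The derivative of `det2` with respect to the component `a` of the `j`-th vector. -/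
def cof (P : Fin 2 → Plane) (a j : Fin 2) : ℝ :=
  (if a = j then 1 else -1) * P (1 - j) (1 - a)

lemma hasFDerivAt_coord (j a : Fin 2) (P : Fin 2 → Plane) :
    HasFDerivAt (fun Q : Fin 2 → Plane => Q j a)
      ((EuclideanSpace.proj (𝕜 := ℝ) a).comp (ContinuousLinearMap.proj (R := ℝ) j)) P :=
  ((EuclideanSpace.proj (𝕜 := ℝ) (ι := Fin 2) a).comp
    (ContinuousLinearMap.proj (R := ℝ) (φ := fun _ : Fin 2 => Plane) j)).hasFDerivAt

lemma differentiable_det2 : Differentiable ℝ det2 := fun P =>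
  (((hasFDerivAt_coord 0 0 P).mul (hasFDerivAt_coord 1 1 P)).sub
    ((hasFDerivAt_coord 0 1 P).mul (hasFDerivAt_coord 1 0 P))).differentiableAt

lemma fderiv_det2_single (P : Fin 2 → Plane) (a j : Fin 2) :
    fderiv ℝ det2 P (Pi.single j (basisVec a)) = cof P a j := by
  have h := ((hasFDerivAt_coord 0 0 P).mul (hasFDerivAt_coord 1 1 P)).sub
    ((hasFDerivAt_coord 0 1 P).mul (hasFDerivAt_coord 1 0 P))
  have e : fderiv ℝ det2 P = _ := h.fderiv
  rw [e]
  fin_cases a <;> fin_cases j <;> simp [cof, basisVec]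

lemma pd_coord {ξ : Plane → Plane} {x : Plane} (h : DifferentiableAt ℝ ξ x) (i b : Fin 2) :
    pd i (fun y => ξ y b) x = pd i ξ x b := by
  have := ((EuclideanSpace.proj (𝕜 := ℝ) (ι := Fin 2) b).hasFDerivAt.comp x h.hasFDerivAt).fderiv
  exact congrArg (fun L : Plane →L[ℝ] ℝ => L (basisVec i)) this

lemma plane_eq_sum (v : Plane) : v = v 0 • (basisVec 0 : Plane) + v 1 • (basisVec 1 : Plane) := by
  ext k
  fin_cases k <;> simp [basisVec]

/-- The chain rule for partial derivatives in the plane. -/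
lemma pd_comp {F : Type*} [NormedAddCommGroup F] [NormedSpace ℝ F] {f : Plane → F}
    {ξ : Plane → Plane} {x : Plane} (hf : DifferentiableAt ℝ f (ξ x))
    (hξ : DifferentiableAt ℝ ξ x) (j : Fin 2) :
    pd j (fun y => f (ξ y)) x = pd j ξ x 0 • pd 0 f (ξ x) + pd j ξ x 1 • pd 1 f (ξ x) := by
  have h := congrArg (fun L : Plane →L[ℝ] F => L (basisVec j))
    (hf.hasFDerivAt.comp x hξ.hasFDerivAt).fderiv
  refine h.trans ?_
  change fderiv ℝ f (ξ x) (pd j ξ x) = _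
  conv_lhs => rw [plane_eq_sum (pd j ξ x)]
  rw [map_add, map_smul, map_smul]
  rfl

/-- The cofactors of a Jacobian matrix, multiplied with a function of the field: the null
Lagrangian `F(ξ) det ∂ξ` satisfies the Euler-Lagrange equations identically. -/
lemma sum_pd_mul_cof {F : Plane → ℝ} {ξ : Plane → Plane} {x : Plane}
    (hF : DifferentiableAt ℝ F (ξ x)) (hξ : ContDiffAt ℝ 2 ξ x) (a : Fin 2) :
    (∀ j, DifferentiableAt ℝ (fun y => F (ξ y) * cof (fun i => pd i ξ y) a j) x) ∧
    ∑ j, pd j (fun y => F (ξ y) * cof (fun i => pd i ξ y) a j) x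
      = pd a F (ξ x) * det2 (fun i => pd i ξ x) := by
  have hd : DifferentiableAt ℝ ξ x := hξ.differentiableAt (by norm_num)
  have hFξ : DifferentiableAt ℝ (fun y => F (ξ y)) x := hF.comp x hd
  have hpd : ∀ i, DifferentiableAt ℝ (pd i ξ) x := fun i =>
    (((hξ.fderiv_right (m := 1) (by norm_num)).differentiableAt (by norm_num))).clm_apply
      (differentiableAt_const _)
  have hc : ∀ i b, DifferentiableAt ℝ (fun y => pd i ξ y b) x := fun i b =>
    (EuclideanSpace.proj (𝕜 := ℝ) (ι := Fin 2) b).differentiableAt.comp x (hpd i)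
  have hcof : ∀ j, DifferentiableAt ℝ (fun y => cof (fun i => pd i ξ y) a j) x := fun j =>
    (hc (1 - j) (1 - a)).const_mul _
  refine ⟨fun j => hFξ.mul (hcof j), ?_⟩
  -- In `Fin 2`, `1 - j` is the other index.
  have e : ∀ j, pd j (fun y => F (ξ y) * cof (fun i => pd i ξ y) a j) x
      = F (ξ x) * ((if a = j then 1 else -1) * pd j (pd (1 - j) ξ) x (1 - a))
        + cof (fun i => pd i ξ x) a j * pd j (fun y => F (ξ y)) x := by
    intro j
    have h1 : pd j (fun y => cof (fun i => pd i ξ y) a j) x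
        = (if a = j then 1 else -1) * pd j (pd (1 - j) ξ) x (1 - a) := by
      rw [← pd_coord (hpd _)]
      exact congrArg (fun L : Plane →L[ℝ] ℝ => L (basisVec j)) (fderiv_const_mul (hc _ _) _)
    rw [← h1]
    exact congrArg (fun L : Plane →L[ℝ] ℝ => L (basisVec j)) (fderiv_fun_mul hFξ (hcof j))
  have hs := pd_pd_comm hξ 0 1
  rw [Fin.sum_univ_two, e, e, pd_comp hF hd, pd_comp hF hd]
  -- The cofactors are divergence free by symmetry of second derivatives, and contracting them with
  -- `∂ⱼξᵇ` gives `det2` for `b = a` and 0 otherwise.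
  fin_cases a <;> simp [cof, det2, hs] <;> ring

/-- A Lagrangian which is the square of a first-order expression plus a null Lagrangian:
fields which annihilate the first-order expression solve the Euler-Lagrange equations. -/
theorem eulerLagrangeAt_of_sq_add_null {L : Plane → Plane → (Fin 2 → Plane) → ℝ} {lam mu : ℝ}
    {W V σ : Plane → ℝ} {ξ : Plane → Plane} {x : Plane}
    (hL : ∀ y q P, L y q P = (lam * (W q * det2 P) - mu * V q - σ y) ^ 2
      + 2 * lam * mu * (W q * V q * det2 P))
    (hξ : ContDiffAt ℝ 2 ξ x) (hW : DifferentiableAt ℝ W (ξ x)) (hV : DifferentiableAt ℝ V (ξ x))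
    (hB : ∀ᶠ y in 𝓝 x,
      lam * (W (ξ y) * det2 (fun i => pd i ξ y)) - mu * V (ξ y) - σ y = 0) :
    EulerLagrangeAt L ξ x := by
  have hjet : ∀ y, HasFDerivAt (L y (ξ y))
      ((2 * (lam * (W (ξ y) * det2 (fun i => pd i ξ y)) - mu * V (ξ y) - σ y)
          * (lam * W (ξ y)) + 2 * lam * mu * (W (ξ y) * V (ξ y)))
        • fderiv ℝ det2 (fun i => pd i ξ y)) (fun i => pd i ξ y) := by
    intro y
    have hd := (differentiable_det2 (fun i => pd i ξ y)).hasFDerivAt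
    have h := (((((hd.const_mul (W (ξ y))).const_mul lam).sub_const (mu * V (ξ y))).sub_const
      (σ y)).pow 2).add ((hd.const_mul (W (ξ y) * V (ξ y))).const_mul (2 * lam * mu))
    have e : L y (ξ y) = _ := funext (hL y (ξ y))
    rw [e]
    refine h.congr_fderiv ?_
    ext Q
    simp
    ring
  have hval : HasFDerivAt (fun q => L x q (fun i => pd i ξ x))
      ((2 * lam * mu * det2 (fun i => pd i ξ x)) • fderiv ℝ (fun q => W q * V q) (ξ x)) (ξ x) := by
    have hWd := hW.hasFDerivAt
    have hVd := hV.hasFDerivAt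
    have hWV := (hW.mul hV).hasFDerivAt
    have h := ((((hWd.mul_const (det2 fun i => pd i ξ x)).const_mul lam).sub
      (hVd.const_mul mu)).sub_const (σ x)).pow 2 |>.add
      ((hWV.mul_const (det2 fun i => pd i ξ x)).const_mul (2 * lam * mu))
    have e : (fun q => L x q (fun i => pd i ξ x)) = _ := funext fun q => hL x q _
    rw [e]
    refine h.congr_fderiv ?_
    ext v
    have h0 := hB.self_of_nhds
    simp [h0]
    rw [← mul_assoc]
    rfl
  -- The square enters the momentum with a factor that vanishes near `x`, not just at `x`. So `σ`,
  -- which may fail to be differentiable, drops out before the momentum is differentiated.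
  have hmom : ∀ a j, momentum L ξ a j =ᶠ[𝓝 x]
      fun y => (2 * lam * mu * (W (ξ y) * V (ξ y))) * cof (fun i => pd i ξ y) a j := by
    intro a j
    filter_upwards [hB] with y hy
    rw [momentum, (hjet y).fderiv, hy]
    simp [fderiv_det2_single]
  have hF : DifferentiableAt ℝ (fun q => 2 * lam * mu * (W q * V q)) (ξ x) :=
    (hW.mul hV).const_mul _
  have hnull := fun a => sum_pd_mul_cof hF hξ a
  refine ⟨?_, .of_forall fun y => (hjet y).differentiableAt, hval.differentiableAt,
    fun a j => ((hnull a).1 j).congr_of_eventuallyEq (hmom a j), fun a => ?_⟩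
  · filter_upwards [hξ.eventually (by simp)] with y hy
    exact hy.differentiableAt (by norm_num)
  · have e1 : ∀ j, pd j (momentum L ξ a j) x
        = pd j (fun y => (2 * lam * mu * (W (ξ y) * V (ξ y))) * cof (fun i => pd i ξ y) a j) x :=
      fun j => by rw [pd, pd, (hmom a j).fderiv_eq]
    have e2 : pd a (fun q => 2 * lam * mu * (W q * V q)) (ξ x)
        = 2 * lam * mu * pd a (fun q => W q * V q) (ξ x) :=
      congrArg (fun L : Plane →L[ℝ] ℝ => L (basisVec a)) (fderiv_const_mul (hW.mul hV) _)
    simp_rw [e1]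
    rw [(hnull a).2, e2, sub_eq_zero]
    have e3 := congrArg (fun L : Plane →L[ℝ] ℝ => L (basisVec a)) hval.fderiv
    refine Eq.trans ?_ e3.symm
    simp only [pd, smul_apply, smul_eq_mul]
    ring

/-! ### Local coordinates on the sphere -/

/-- The charge density of a pair of tangent vectors in terms of local coordinates. -/
lemma chargeJet_fderiv (Φ : Plane → Iso) (q : Plane) (P : Fin 2 → Plane) :
    chargeJet (Φ q) (fun j => fderiv ℝ Φ q (P j))
      = 1 / (4 * Real.pi) * triple (Φ q) (pd 0 Φ q) (pd 1 Φ q) * det2 P := by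
  have h : ∀ j, fderiv ℝ Φ q (P j) = P j 0 • pd 0 Φ q + P j 1 • pd 1 Φ q := by
    intro j
    conv_lhs => rw [plane_eq_sum (P j)]
    rw [map_add, map_smul, map_smul]
    rfl
  rw [chargeJet_eq, h, h, mul_assoc]
  congr 1
  simp only [triple_apply, det2, PiLp.add_apply, PiLp.smul_apply, smul_eq_mul]
  ring

section Chart

variable {e : OpenPartialHomeomorph S2 Plane}

lemma contDiffOn_coe_symm (he : e ∈ IsManifold.maximalAtlas (𝓡 2) ∞ S2) :
    ContDiffOn ℝ ∞ (fun q => (e.symm q : Iso)) e.target := by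
  rw [← contMDiffOn_iff_contDiffOn]
  exact (contMDiff_coe_sphere (n := 2) (m := ∞)).comp_contMDiffOn
    (contMDiffOn_symm_of_mem_maximalAtlas he)

lemma contDiffAt_chart_comp (he : e ∈ IsManifold.maximalAtlas (𝓡 2) ∞ S2) {φ : Plane → S2}
    (hφ : ContDiff ℝ 2 (fun x => (φ x : Iso))) {x : Plane} (hx : φ x ∈ e.source) :
    ContDiffAt ℝ 2 (fun y => e (φ y)) x := by
  have h1 : ContMDiff 𝓘(ℝ, Plane) (𝓡 2) 2 φ :=
    ContMDiff.codRestrict_sphere (n := 2) hφ.contMDiff fun y => (φ y).2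
  have h2 : ContMDiffAt (𝓡 2) (𝓡 2) ∞ e (φ x) :=
    (contMDiffOn_of_mem_maximalAtlas he).contMDiffAt (e.open_source.mem_nhds hx)
  rw [← contMDiffAt_iff_contDiffAt]
  exact (h2.of_le ENat.LEInfty.out).comp x (h1 x)

end Chart

/-- Solutions of the Bogomolnyi equation solve the static Euler-Lagrange equations. -/
theorem staticEulerLagrangeAt_of_bogomolnyi {lam mu : ℝ} {U : S2 → ℝ} (hU0 : ∀ m, 0 ≤ U m)
    {σ : Plane → ℝ} {φ : Plane → S2} (hφ : ContDiff ℝ 2 (fun x => (φ x : Iso)))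
    (hB : ∀ x, bogomolnyi lam mu U σ φ x = 0) {x : Plane}
    (hx : MDifferentiableAt (𝓡 2) 𝓘(ℝ, ℝ) (fun m : S2 => √(U m)) (φ x)) :
    StaticEulerLagrangeAt lam mu U σ φ x := by
  intro e he hex
  let Φ : Plane → Iso := fun q => (e.symm q : Iso)
  let W : Plane → ℝ := fun q => 1 / (4 * Real.pi) * triple (Φ q) (pd 0 Φ q) (pd 1 Φ q)
  let ξ : Plane → Plane := fun y => e (φ y)
  have hsrc : ∀ᶠ y in 𝓝 x, φ y ∈ e.source :=
    (continuous_field hφ).continuousAt.eventually (e.open_source.mem_nhds hex)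
  have hΦ : ∀ {y}, φ y ∈ e.source → ContDiffAt ℝ ∞ Φ (ξ y) := fun hy =>
    (contDiffOn_coe_symm he).contDiffAt (e.open_target.mem_nhds (e.map_source hy))
  refine eulerLagrangeAt_of_sq_add_null (W := W) (V := fun q => √(U (e.symm q))) (lam := lam)
    (mu := mu) (σ := σ) (fun y q P => ?_) (contDiffAt_chart_comp he hφ hex) ?_ ?_ ?_
  -- The splitting is needed for all jets, even for `q` outside the chart's target. It holds there
  -- because `e.symm q` is still a point of the sphere and only linearity of `fderiv` is used.
  · rw [chartLagrangian, density_eq_sq _ _ _ _ (hU0 _), chargeJet_fderiv Φ q P]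
    simp only [W, Φ]
    ring
  · have h1 : DifferentiableAt ℝ Φ (ξ x) := (hΦ hex).differentiableAt (by simp)
    have h2 : ∀ j, DifferentiableAt ℝ (pd j Φ) (ξ x) := fun j =>
      ((((hΦ hex).of_le (m := 2) ENat.LEInfty.out).fderiv_right (m := 1)
        (by norm_num)).differentiableAt (by norm_num)).clm_apply (differentiableAt_const _)
    exact (((contDiff_triple.differentiable (by simp)) _).comp (ξ x)
      (h1.prodMk ((h2 0).prodMk (h2 1)))).const_mul _
  · have h1 : MDifferentiableAt (𝓡 2) (𝓡 2) e.symm (e (φ x)) :=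
      ((contMDiffOn_symm_of_mem_maximalAtlas he).contMDiffAt
        (e.open_target.mem_nhds (e.map_source hex))).mdifferentiableAt (by simp)
    have h2 : MDifferentiableAt (𝓡 2) 𝓘(ℝ, ℝ) (fun m : S2 => √(U m)) (e.symm (e (φ x))) := by
      rwa [e.left_inv hex]
    exact (h2.comp (e (φ x)) h1).differentiableAt
  -- Comparing derivatives at `y` requires the field to stay in the chart on a neighbourhood of `y`.
  · filter_upwards [hsrc.eventually_nhds] with y hy
    have hys := hy.self_of_nhds
    have hφξ : (fun z => (φ z : Iso)) =ᶠ[𝓝 y] fun z => Φ (ξ z) := by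
      filter_upwards [hy] with z hz
      simp only [Φ, ξ, e.left_inv hz]
    have hpd : ∀ j, pd j (fun z => (φ z : Iso)) y = fderiv ℝ Φ (ξ y) (pd j ξ y) := by
      intro j
      rw [pd, hφξ.fderiv_eq]
      have h := (((hΦ hys).differentiableAt (by simp)).hasFDerivAt.comp y
        ((contDiffAt_chart_comp he hφ hys).differentiableAt (by norm_num)).hasFDerivAt).fderiv
      exact congrArg (fun L : Plane →L[ℝ] Iso => L (basisVec j)) h
    have hb := hB y
    have hc : chargeDensity φ y = W (ξ y) * det2 (fun i => pd i ξ y) := by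
      have h0 : (φ y : Iso) = Φ (ξ y) := hφξ.self_of_nhds
      simp_rw [chargeDensity, hpd]
      rw [h0]
      exact chargeJet_fderiv Φ (ξ y) _
    rw [bogomolnyi, hc] at hb
    simpa only [e.left_inv hys, ξ] using hb

end BabySkyrme

end

theorem mainTheorem3 (lam mu : ℝ)
    (U : BabySkyrme.S2 → ℝ) (hU : Continuous U) (hU_nonneg : ∀ m, 0 ≤ U m)
    (σ : BabySkyrme.Plane → ℝ) (hσ : Continuous σ)
    (φ : BabySkyrme.Plane → BabySkyrme.S2)
    (hφ : ContDiff ℝ 2 (fun x => (φ x : BabySkyrme.Iso))) :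
    -- the topological bound and its saturation
    ((∃ φinf : BabySkyrme.S2, Tendsto φ (cocompact BabySkyrme.Plane) (𝓝 φinf)) →
      Integrable (BabySkyrme.chargeDensity φ) →
        (Integrable (BabySkyrme.energyDensity lam mu U σ φ) →
          BabySkyrme.energy lam mu U σ φ
              = (∫ x, BabySkyrme.bogomolnyi lam mu U σ φ x ^ 2)
                + 2 * lam * mu * ∫ x, BabySkyrme.chargeDensity φ x * √(U (φ x))) ∧
        (∫ x, BabySkyrme.chargeDensity φ x * √(U (φ x))
          = BabySkyrme.charge φ * BabySkyrme.avgSqrt U) ∧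
        (Integrable (BabySkyrme.energyDensity lam mu U σ φ) →
          2 * lam * mu * BabySkyrme.charge φ * BabySkyrme.avgSqrt U
            ≤ BabySkyrme.energy lam mu U σ φ) ∧
        ((Integrable (BabySkyrme.energyDensity lam mu U σ φ) ∧
            BabySkyrme.energy lam mu U σ φ
              = 2 * lam * mu * BabySkyrme.charge φ * BabySkyrme.avgSqrt U) ↔
          ∀ x, BabySkyrme.bogomolnyi lam mu U σ φ x = 0)) ∧
    -- solutions of the Bogomolnyi equation solve the static Euler-Lagrange equations
    ((∀ x, BabySkyrme.bogomolnyi lam mu U σ φ x = 0) →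
      ∀ x, MDifferentiableAt (𝓡 2) 𝓘(ℝ, ℝ) (fun m : BabySkyrme.S2 => √(U m)) (φ x) →
        BabySkyrme.StaticEulerLagrangeAt lam mu U σ φ x) := by
  refine ⟨fun ⟨φinf, hlim⟩ hB => ?_, fun hB x hx =>
    BabySkyrme.staticEulerLagrangeAt_of_bogomolnyi hU_nonneg hφ hB hx⟩
  have hdeg := BabySkyrme.integral_chargeDensity_mul_sqrt hU hφ hlim hB
  refine ⟨BabySkyrme.energy_eq hU hU_nonneg hφ hB, hdeg, fun hE => ?_,
    BabySkyrme.energy_eq_bound_iff hU hU_nonneg hσ hφ hlim hB⟩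
  rw [BabySkyrme.energy_eq hU hU_nonneg hφ hB hE, hdeg, ← mul_assoc]
  exact le_add_of_nonneg_left (integral_nonneg fun x => sq_nonneg _)
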